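/- Let $k$ be an algebraically closed field of characteristic $0$, and let $R = k[X_1,\dots,X_r] = \bigoplus_{d\ge 0} R_d$ with the standard grading. Let $I = \bigoplus_d I_d \subseteq R$ be a homogeneous ideal with $I_0 = I_1 = 0$ such that $A = R/I = \bigoplus_{d} A_d$, $A_d = R_d/I_d$, is finite-dimensional over $k$, and let $j$ be the largest integer with $A_j \neq 0$. Then $A$ is said to have codimension $r$; it is called level if its socle $\{a \in A : aA_1 = 0\}$ equals $A_j$, and in that case its type is $\dim_k A_j$. The algebra $A$ is called unimodal if for some $0 \le i \le j$ its Hilbert function $h_A(d) = \dim_k A_d$ is nondecreasing for $0 \le d \le i$ and nonincreasing for $i \le d \le j$, and non-unimodal otherwise. Proposition. For all integers $r \ge 5$ and $t \ge 1$ there exists a non-unimodal level algebra of codimension $r$ and type $t$. -/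

import Mathlib

open MvPolynomial

noncomputable section

namespace LevelAlgebra

attribute [local instance] MvPolynomial.gradedAlgebra

variable {k : Type*} [Field k] {r : ℕ}

/-- The degree-`d` graded piece `A_d = R_d / I_d` of `A = R / I`, where `R = k[X_1, …, X_r]` has
the standard grading: it is the image of the space of forms of degree `d`. -/
def gradedPiece (I : Ideal (MvPolynomial (Fin r) k)) (d : ℕ) :
    Submodule k (MvPolynomial (Fin r) k ⧸ I) :=
  (homogeneousSubmodule (Fin r) k d).map (Ideal.Quotient.mkₐ k I).toLinearMap

/-- The Hilbert function `h_A(d) = dim_k A_d` of `A = R / I`. -/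
def hilbertFunction (I : Ideal (MvPolynomial (Fin r) k)) (d : ℕ) : ℕ :=
  Module.finrank k (gradedPiece I d)

/-- The socle `{a ∈ A | a A_1 = 0}` of `A = R / I`. -/
def socle (I : Ideal (MvPolynomial (Fin r) k)) :
    Submodule k (MvPolynomial (Fin r) k ⧸ I) where
  carrier := {a | ∀ b ∈ gradedPiece I 1, a * b = 0}
  zero_mem' := fun b _ => zero_mul b
  add_mem' := fun {a a'} ha ha' b hb => by rw [add_mul, ha b hb, ha' b hb, add_zero]
  smul_mem' := fun c a ha b hb => by rw [smul_mul_assoc, ha b hb, smul_zero]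

/-- `R / I` is a graded Artinian quotient of `R = k[X_1, …, X_r]` of codimension `r`: the ideal
`I` is homogeneous, it contains no nonzero form of degree `0` or `1`, and `R / I` is
finite-dimensional over `k`. -/
structure IsGradedArtinianQuotient (I : Ideal (MvPolynomial (Fin r) k)) : Prop where
  homogeneous : I.IsHomogeneous (homogeneousSubmodule (Fin r) k)
  eq_zero_of_degree_le_one : ∀ F ∈ I, ∀ d ≤ 1, F.IsHomogeneous d → F = 0
  finite : Module.Finite k (MvPolynomial (Fin r) k ⧸ I)

/-- `j` is the largest degree in which `A = R / I` is nonzero. -/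
def IsTopDegree (I : Ideal (MvPolynomial (Fin r) k)) (j : ℕ) : Prop :=
  gradedPiece I j ≠ ⊥ ∧ ∀ d, j < d → gradedPiece I d = ⊥

/-- `A = R / I` is a level algebra of codimension `r`, socle degree `j` and type `t`. -/
structure IsLevel (I : Ideal (MvPolynomial (Fin r) k)) (j t : ℕ) : Prop where
  artinian : IsGradedArtinianQuotient I
  topDegree : IsTopDegree I j
  socle_eq : gradedPiece I j = socle I
  type_eq : Module.finrank k (gradedPiece I j) = t

/-- A function `h`, considered in degrees `0, …, j`, is unimodal: for some `i` it is
nondecreasing on `[0, i]` and nonincreasing on `[i, j]`. -/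
def IsUnimodal (h : ℕ → ℕ) (j : ℕ) : Prop :=
  ∃ i ≤ j, MonotoneOn h (Set.Icc 0 i) ∧ AntitoneOn h (Set.Icc i j)

end LevelAlgebra

end

namespace LevelAlgebra

attribute [local instance] MvPolynomial.gradedAlgebra

/-! ### Ideals apolar to a vector-valued functional on forms of degree `j` -/

section Apolar

variable {k V : Type*} [Field k] [AddCommGroup V] [Module k V] {r : ℕ}

/-! The algebra is built from an inverse system. A linear map `Φ` on forms of degree `j` determines
an ideal `apolarIdeal j Φ`, and the quotient by it automatically has its socle exactly in degree `j`
(`socle_apolarIdeal`). Only the choice of `Φ` matters.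

Write r = n + 3, t = s + 1, and let N(d) be the number of monomials of degree d in the last n + 1 ≥
3 variables. Take j = 2m + 4 with m large. One component of `Φ` is the sum of ∂₀f(0,0,p) over a
finite set P plus the sum of ∂₁f(0,0,p) over a finite set Q. The other s components are evaluations
at side points, which raise the type to s + 1.

The points are general, with |P| + |Q| = N(m+3) and |P|, |Q| ≤ N(m). This is possible because N(m+3)
≤ 2N(m) for large m (`multichoose_add_three_le`, `exists_isGeneralPair`). For m+1 ≤ d ≤ m+3 a form f
of degree d lies in the ideal exactly when three things vanish: its restriction to x₀ = x₁ = 0, its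
weighted normal derivatives as a functional on forms of degree j-d, and its values at the side
points. These data are independent, so h(d) = N(d) + N(j-d) + s
(`IsGeneralPair.hilbertFunction_middle`).

Since N is strictly convex (`two_mul_multichoose_lt`), h(m+2) is strictly smaller than h(m+1) =
h(m+3), so h is not unimodal. -/

lemma homogeneousComponent_mul_of_isHomogeneous {σ : Type*} {f : MvPolynomial σ k} {d : ℕ}
    (hf : f.IsHomogeneous d) (g : MvPolynomial σ k) (j : ℕ) :
    homogeneousComponent j (f * g) =
      if d ≤ j then f * homogeneousComponent (j - d) g else 0 := by
  conv_lhs => rw [← sum_homogeneousComponent g, Finset.mul_sum, map_sum]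
  have key : ∀ i, homogeneousComponent j (f * homogeneousComponent i g) =
      if d + i = j then f * homogeneousComponent i g else 0 := fun i => by
    rw [homogeneousComponent_of_mem (hf.mul (homogeneousComponent_isHomogeneous i g))]
    simp only [eq_comm]
  simp only [key]
  split_ifs with h
  · by_cases hj : j - d ∈ Finset.range (g.totalDegree + 1)
    · rw [Finset.sum_eq_single_of_mem _ hj]
      · rw [if_pos (by omega)]
      · intro b _ hb
        rw [if_neg (by omega)]
    · rw [homogeneousComponent_eq_zero _ _ (by rw [Finset.mem_range] at hj; omega), mul_zero]
      refine Finset.sum_eq_zero fun i hi => if_neg ?_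
      rintro rfl
      exact hj (by simpa using hi)
  · exact Finset.sum_eq_zero fun i _ => if_neg (by omega)

/-- The ideal of all `f` such that `Φ` vanishes on the degree-`j` components of all multiples
of `f`: the annihilator of the inverse system generated by the components of `Φ` in degree `j`. -/
def apolarIdeal (j : ℕ) (Φ : MvPolynomial (Fin r) k →ₗ[k] V) : Ideal (MvPolynomial (Fin r) k) where
  carrier := {f | ∀ g, Φ (homogeneousComponent j (f * g)) = 0}
  zero_mem' := fun g => by simp
  add_mem' := fun {a b} ha hb g => by rw [add_mul, map_add, map_add, ha g, hb g, add_zero]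
  smul_mem' := fun c f hf g => by
    rw [smul_eq_mul, mul_comm c f, mul_assoc]
    exact hf (c * g)

variable {j : ℕ} {Φ : MvPolynomial (Fin r) k →ₗ[k] V}

lemma mem_apolarIdeal {f : MvPolynomial (Fin r) k} :
    f ∈ apolarIdeal j Φ ↔ ∀ g, Φ (homogeneousComponent j (f * g)) = 0 := Iff.rfl

lemma mem_apolarIdeal_iff_of_isHomogeneous {f : MvPolynomial (Fin r) k} {d : ℕ}
    (hf : f.IsHomogeneous d) (hd : d ≤ j) :
    f ∈ apolarIdeal j Φ ↔
      ∀ g : MvPolynomial (Fin r) k, g.IsHomogeneous (j - d) → Φ (f * g) = 0 := by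
  simp only [mem_apolarIdeal, homogeneousComponent_mul_of_isHomogeneous hf, if_pos hd]
  constructor
  · intro h g hg
    simpa only [homogeneousComponent_eq_self hg] using h g
  · exact fun h g => h _ (homogeneousComponent_isHomogeneous _ g)

lemma mem_apolarIdeal_of_lt {f : MvPolynomial (Fin r) k} {d : ℕ}
    (hf : f.IsHomogeneous d) (hd : j < d) : f ∈ apolarIdeal j Φ := fun g => by
  rw [homogeneousComponent_mul_of_isHomogeneous hf, if_neg (by omega), map_zero]

lemma homogeneousComponent_mem_apolarIdeal {f : MvPolynomial (Fin r) k}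
    (hf : f ∈ apolarIdeal j Φ) (d : ℕ) : homogeneousComponent d f ∈ apolarIdeal j Φ := by
  rcases le_or_gt d j with hd | hd
  · rw [mem_apolarIdeal_iff_of_isHomogeneous (homogeneousComponent_isHomogeneous d f) hd]
    intro g hg
    have := hf g
    rwa [mul_comm, homogeneousComponent_mul_of_isHomogeneous hg, if_pos (by omega), mul_comm,
      show j - (j - d) = d by omega] at this
  · exact mem_apolarIdeal_of_lt (homogeneousComponent_isHomogeneous d f) hd

lemma apolarIdeal_isHomogeneous :
    (apolarIdeal j Φ).IsHomogeneous (homogeneousSubmodule (Fin r) k) := by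
  intro i f hf
  have : (DirectSum.decompose (homogeneousSubmodule (Fin r) k) f i : MvPolynomial (Fin r) k) =
      homogeneousComponent i f := decomposition.decompose'_apply f i
  rw [this]
  exact homogeneousComponent_mem_apolarIdeal hf i

lemma mk_eq_zero_of_lt {f : MvPolynomial (Fin r) k} {d : ℕ}
    (hf : f.IsHomogeneous d) (hd : j < d) : Ideal.Quotient.mk (apolarIdeal j Φ) f = 0 :=
  Ideal.Quotient.eq_zero_iff_mem.2 (mem_apolarIdeal_of_lt hf hd)

lemma gradedPiece_apolarIdeal_eq_bot {d : ℕ} (hd : j < d) :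
    gradedPiece (apolarIdeal j Φ) d = ⊥ := by
  rw [eq_bot_iff]
  rintro _ ⟨f, hf, rfl⟩
  exact mk_eq_zero_of_lt hf hd

lemma finite_quotient_apolarIdeal :
    Module.Finite k (MvPolynomial (Fin r) k ⧸ apolarIdeal j Φ) := by
  refine Module.Finite.of_surjective
    ((Ideal.Quotient.mkₐ k (apolarIdeal j Φ)).toLinearMap ∘ₗ
      (restrictTotalDegree (Fin r) k j).subtype) ?_
  intro a
  obtain ⟨f, rfl⟩ := Ideal.Quotient.mk_surjective a
  refine ⟨⟨∑ i ∈ Finset.range (j + 1), homogeneousComponent i f, ?_⟩, ?_⟩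
  · refine Submodule.sum_mem _ fun i hi => ?_
    rw [mem_restrictTotalDegree]
    exact (homogeneousComponent_isHomogeneous i f).totalDegree_le.trans
      (by simpa [Nat.lt_succ_iff] using hi)
  · change Ideal.Quotient.mk (apolarIdeal j Φ)
      (∑ i ∈ Finset.range (j + 1), homogeneousComponent i f) = Ideal.Quotient.mk (apolarIdeal j Φ) f
    rw [Ideal.Quotient.eq, mem_iff_homogeneousComponent_mem apolarIdeal_isHomogeneous]
    intro d
    rw [map_sub, map_sum]
    simp only [homogeneousComponent_of_mem (homogeneousComponent_mem _ f)]
    rcases le_or_gt d j with hd | hd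
    · rw [Finset.sum_ite_eq, if_pos (by simp; omega), sub_self]
      exact zero_mem _
    · rw [Finset.sum_ite_eq, if_neg (by simp; omega), zero_sub]
      exact neg_mem (mem_apolarIdeal_of_lt (homogeneousComponent_isHomogeneous d f) hd)

/-- A form of positive degree is a combination of the variables. -/
lemma exists_eq_sum_X_mul {σ : Type*} [Fintype σ] {g : MvPolynomial σ k}
    (hg : coeff 0 g = 0) : ∃ h : σ → MvPolynomial σ k, g = ∑ i, X i * h i := by
  have : g ∈ Ideal.span (Set.range (X : σ → MvPolynomial σ k)) := by
    rw [← Set.image_univ, mem_ideal_span_X_image]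
    intro m hm
    by_contra! h
    have : m = 0 := by ext i; exact h i (Set.mem_univ i)
    rw [this, mem_support_iff] at hm
    exact hm hg
  rw [Ideal.mem_span_range_iff_exists_fun] at this
  obtain ⟨c, hc⟩ := this
  exact ⟨c, by simp only [← hc, mul_comm]⟩

/-- Below degree `j` every complementary form has positive degree, hence is a combination of the
variables. This is why the socle has nothing outside degree `j`. -/
lemma mem_apolarIdeal_of_forall_X_mul {f : MvPolynomial (Fin r) k} {d : ℕ}
    (hf : f.IsHomogeneous d) (hd : d ≠ j) (h : ∀ i, f * X i ∈ apolarIdeal j Φ) :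
    f ∈ apolarIdeal j Φ := by
  rcases lt_or_gt_of_ne hd with hd | hd
  · rw [mem_apolarIdeal_iff_of_isHomogeneous hf hd.le]
    intro g hg
    obtain ⟨c, rfl⟩ := exists_eq_sum_X_mul (hg.coeff_eq_zero (d := 0) (by simp; omega))
    have hm : f * ∑ i, X i * c i ∈ apolarIdeal j Φ := by
      rw [Finset.mul_sum]
      refine sum_mem fun i _ => ?_
      rw [← mul_assoc]
      exact Ideal.mul_mem_right _ _ (h i)
    have := hm 1
    have e : (f * ∑ i, X i * c i).IsHomogeneous j := by
      have := hf.mul hg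
      rwa [Nat.add_sub_cancel' hd.le] at this
    rwa [mul_one, homogeneousComponent_eq_self e] at this
  · exact mem_apolarIdeal_of_lt hf hd

lemma socle_apolarIdeal : gradedPiece (apolarIdeal j Φ) j = socle (apolarIdeal j Φ) := by
  apply le_antisymm
  · rintro _ ⟨f, hf, rfl⟩ _ ⟨g, hg, rfl⟩
    have := mk_eq_zero_of_lt (j := j) (Φ := Φ) (IsHomogeneous.mul hf hg) (Nat.lt_succ_self j)
    rwa [map_mul] at this
  · intro a ha
    obtain ⟨f, rfl⟩ := Ideal.Quotient.mk_surjective a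
    have hX : ∀ i, f * X i ∈ apolarIdeal j Φ := fun i => by
      rw [← Ideal.Quotient.eq_zero_iff_mem, map_mul]
      exact ha _ ⟨X i, isHomogeneous_X k i, rfl⟩
    refine ⟨homogeneousComponent j f, homogeneousComponent_isHomogeneous j f, ?_⟩
    change Ideal.Quotient.mk (apolarIdeal j Φ) _ = Ideal.Quotient.mk (apolarIdeal j Φ) f
    rw [Ideal.Quotient.eq, mem_iff_homogeneousComponent_mem apolarIdeal_isHomogeneous]
    intro d
    rw [map_sub, homogeneousComponent_of_mem (homogeneousComponent_mem j f)]
    split_ifs with hd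
    · rw [hd, sub_self]
      exact zero_mem _
    · rw [zero_sub]
      refine neg_mem (mem_apolarIdeal_of_forall_X_mul (homogeneousComponent_isHomogeneous d f) hd
        fun i => ?_)
      have := homogeneousComponent_mem_apolarIdeal (hX i) (d + 1)
      rwa [mul_comm, homogeneousComponent_mul_of_isHomogeneous (isHomogeneous_X k i),
        if_pos (by omega), mul_comm, Nat.add_sub_cancel] at this

lemma isLevel_apolarIdeal {t : ℕ} (hr : 0 < r) (ht : 0 < t)
    (hI : ∀ f ∈ apolarIdeal j Φ, f.IsHomogeneous 1 → f = 0)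
    (htype : hilbertFunction (apolarIdeal j Φ) j = t) : IsLevel (apolarIdeal j Φ) j t where
  artinian :=
    { homogeneous := apolarIdeal_isHomogeneous
      eq_zero_of_degree_le_one := by
        intro F hF d hd hFd
        obtain rfl | rfl : d = 0 ∨ d = 1 := by omega
        -- A constant in the ideal is multiplied by a variable, which reduces degree 0 to degree 1.
        · have := hI _ (Ideal.mul_mem_right (X ⟨0, hr⟩) _ hF) (by
            simpa using hFd.mul (isHomogeneous_X k (⟨0, hr⟩ : Fin r)))
          exact (mul_eq_zero.1 this).resolve_right (X_ne_zero _)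
        · exact hI F hF hFd
      finite := finite_quotient_apolarIdeal }
  topDegree := by
    refine ⟨fun h => ?_, fun d hd => gradedPiece_apolarIdeal_eq_bot hd⟩
    rw [hilbertFunction, h, finrank_bot] at htype
    omega
  socle_eq := socle_apolarIdeal
  type_eq := htype

/-- The Hilbert function in degree `d` is the dimension of the target of any surjective linear
map from the forms of degree `d` whose kernel is `I_d`. -/
lemma hilbertFunction_eq_finrank {I : Ideal (MvPolynomial (Fin r) k)} {d : ℕ}
    (Ψ : homogeneousSubmodule (Fin r) k d →ₗ[k] V) (hΨ : Function.Surjective Ψ)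
    (hker : ∀ f, Ψ f = 0 ↔ (f : MvPolynomial (Fin r) k) ∈ I) :
    hilbertFunction I d = Module.finrank k V := by
  set π : homogeneousSubmodule (Fin r) k d →ₗ[k] MvPolynomial (Fin r) k ⧸ I :=
    (Ideal.Quotient.mkₐ k I).toLinearMap ∘ₗ (homogeneousSubmodule (Fin r) k d).subtype with hπ
  have hrange : gradedPiece I d = LinearMap.range π := by
    rw [hπ, LinearMap.range_comp, Submodule.range_subtype]
    rfl
  have hk : LinearMap.ker π = LinearMap.ker Ψ := by
    ext f
    rw [LinearMap.mem_ker, LinearMap.mem_ker, hker]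
    exact Ideal.Quotient.eq_zero_iff_mem
  rw [hilbertFunction, hrange, ← π.quotKerEquivRange.finrank_eq,
    (Submodule.quotEquivOfEq _ _ hk).finrank_eq, (Ψ.quotKerEquivOfSurjective hΨ).finrank_eq]

/-- A strict dip at `m` excludes a peak on either side of it. -/
lemma not_isUnimodal {h : ℕ → ℕ} {j m : ℕ} (hm : 1 ≤ m) (hj : m + 1 ≤ j)
    (h₁ : h m < h (m - 1)) (h₂ : h m < h (m + 1)) : ¬ IsUnimodal h j := by
  rintro ⟨i, hi, hmono, hanti⟩
  rcases le_total m i with hmi | hmi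
  · exact absurd (hmono (a := m - 1) (b := m) ⟨by omega, by omega⟩ ⟨by omega, hmi⟩ (by omega))
      (by omega)
  · exact absurd (hanti (a := m) (b := m + 1) ⟨hmi, by omega⟩ ⟨by omega, hj⟩ (by omega))
      (by omega)

end Apolar

/-! ### Growth and convexity of the number of monomials -/

lemma multichoose_pos {n : ℕ} (hn : 0 < n) (d : ℕ) : 0 < n.multichoose d := by
  rw [Nat.multichoose_eq]
  exact Nat.choose_pos (by omega)

/-- The dimension of the space of forms of degree `d` in at least three variables is a strictly
convex function of `d`. -/
lemma two_mul_multichoose_lt {n : ℕ} (hn : 3 ≤ n) {m : ℕ} (hm : 1 ≤ m) :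
    2 * n.multichoose m < n.multichoose (m + 1) + n.multichoose (m - 1) := by
  obtain ⟨n, rfl⟩ : ∃ l, n = l + 3 := ⟨n - 3, by omega⟩
  obtain ⟨m, rfl⟩ : ∃ l, m = l + 1 := ⟨m - 1, by omega⟩
  -- By Pascal's rule applied twice, the second difference is the number of monomials of degree m +
  -- 2 in two fewer variables, which is positive.
  have h₁ := Nat.multichoose_succ_succ (n + 2) (m + 1)
  have h₂ := Nat.multichoose_succ_succ (n + 2) m
  have h₃ := Nat.multichoose_succ_succ (n + 1) (m + 1)
  have := multichoose_pos (n := n + 1) (by omega) (m + 1 + 1)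
  simp only [Nat.add_sub_cancel, add_assoc, Nat.reduceAdd] at *
  omega

lemma succ_mul_multichoose_succ (n d : ℕ) :
    (d + 1) * n.multichoose (d + 1) = (n + d) * n.multichoose d := by
  rcases n with _ | n
  · rcases d with _ | d <;> simp
  · rw [Nat.multichoose_eq, Nat.multichoose_eq, show n + 1 + (d + 1) - 1 = n + d + 1 by omega,
      show n + 1 + d - 1 = n + d by omega, show n + 1 + d = n + d + 1 by omega,
      Nat.add_one_mul_choose_eq, mul_comm]

lemma four_mul_multichoose_succ_le {n d : ℕ} (h : 4 * n ≤ d) :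
    4 * n.multichoose (d + 1) ≤ 5 * n.multichoose d := by
  have := succ_mul_multichoose_succ n d
  have h' : 4 * (n + d) ≤ 5 * (d + 1) := by omega
  refine Nat.le_of_mul_le_mul_left (c := d + 1) ?_ (by omega)
  calc (d + 1) * (4 * n.multichoose (d + 1)) = 4 * (n + d) * n.multichoose d := by
        rw [mul_left_comm, this, mul_assoc]
    _ ≤ 5 * (d + 1) * n.multichoose d := Nat.mul_le_mul_right _ h'
    _ = (d + 1) * (5 * n.multichoose d) := by ring

/-- Three consecutive ratios are at most 5/4, and (5/4)³ = 125/64 < 2. -/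
lemma multichoose_add_three_le {n d : ℕ} (h : 4 * n ≤ d) :
    n.multichoose (d + 3) ≤ 2 * n.multichoose d := by
  have h₁ := four_mul_multichoose_succ_le h
  have h₂ := four_mul_multichoose_succ_le (n := n) (d := d + 1) (by omega)
  have h₃ := four_mul_multichoose_succ_le (n := n) (d := d + 2) (by omega)
  simp only [add_assoc, Nat.reduceAdd] at h₂ h₃
  omega

lemma multichoose_lt_succ {n : ℕ} (hn : 2 ≤ n) (d : ℕ) :
    n.multichoose d < n.multichoose (d + 1) := by
  obtain ⟨n, rfl⟩ : ∃ l, n = l + 1 := ⟨n - 1, by omega⟩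
  rw [Nat.multichoose_succ_succ n d]
  have := multichoose_pos (n := n) (by omega) (d + 1)
  omega

instance finite_homogeneousSubmodule {k : Type*} [Field k] (n d : ℕ) :
    Module.Finite k (homogeneousSubmodule (Fin n) k d) :=
  Module.Finite.iff_fg.2 (homogeneousSubmodule_fg _ _ d)

lemma finrank_homogeneousSubmodule {k : Type*} [Field k] (n d : ℕ) :
    Module.finrank k (homogeneousSubmodule (Fin n) k d) = n.multichoose d := by
  have hs : {c : Fin n →₀ ℕ | c.degree = d} =
      ((Finset.univ : Finset (Fin n)).finsuppAntidiag d : Set (Fin n →₀ ℕ)) := by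
    ext c
    simp [Finsupp.degree_eq_sum]
  rw [homogeneousSubmodule_eq_finsupp_supported, hs]
  rw [(AddMonoidAlgebra.supportedEquivFinsupp (R := k) (S := k)
    ((Finset.univ : Finset (Fin n)).finsuppAntidiag d : Set (Fin n →₀ ℕ))).finrank_eq]
  simp [Finset.card_finsuppAntidiag_nat_eq_multichoose]

/-! ### General points and the conditions they impose on forms -/

section Points

variable {k : Type*} [Field k] {n : ℕ}

/-- Evaluation at `p`, as a functional on the forms of degree `d`. -/
noncomputable def evalForm (d : ℕ) (p : Fin n → k) : Module.Dual k (homogeneousSubmodule (Fin n) k d) :=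
  (aeval p).toLinearMap ∘ₗ (homogeneousSubmodule (Fin n) k d).subtype

lemma evalForm_apply (d : ℕ) (p : Fin n → k) (f : homogeneousSubmodule (Fin n) k d) :
    evalForm d p f = eval p (f : MvPolynomial (Fin n) k) := by
  rw [evalForm, LinearMap.comp_apply, AlgHom.toLinearMap_apply, Submodule.subtype_apply,
    aeval_eq_eval]

/-- A proper subspace of the dual is killed by a nonzero element of the bidual, which by finite
dimension is a form. -/
lemma exists_form_of_lt_top {d : ℕ}
    {U : Submodule k (Module.Dual k (homogeneousSubmodule (Fin n) k d))} (hU : U < ⊤) :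
    ∃ f : MvPolynomial (Fin n) k, f.IsHomogeneous d ∧ f ≠ 0 ∧
      ∀ p, evalForm d p ∈ U → eval p f = 0 := by
  obtain ⟨g, hg, hgU⟩ := Submodule.exists_le_ker_of_lt_top U hU
  set f := (Module.evalEquiv k (homogeneousSubmodule (Fin n) k d)).symm g with hf
  refine ⟨f, f.2, ?_, ?_⟩
  · rw [Ne, ZeroMemClass.coe_eq_zero, hf, LinearEquiv.map_eq_zero_iff]
    exact hg
  · intro p hpU
    rw [← evalForm_apply d, hf, Module.apply_evalEquiv_symm_apply]
    exact hgU hpU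

lemma span_evalForm_lt_top {d : ℕ} {P : Finset (Fin n → k)} (hP : P.card < n.multichoose d) :
    Submodule.span k (evalForm d '' (P : Set (Fin n → k))) < ⊤ := by
  classical
  rw [lt_top_iff_ne_top]
  intro h
  have h₁ := finrank_span_finset_le_card (R := k) (P.image (evalForm d))
  rw [Finset.coe_image, Set.finrank, h, finrank_top, Subspace.dual_finrank_eq,
    finrank_homogeneousSubmodule] at h₁
  have := Finset.card_image_le (s := P) (f := evalForm d)
  omega

/-- General points: as long as the dimensions allow it, a point can be added to `P` that imposes an
independent condition both on the forms of degree `d` vanishing on `P` and on the forms of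
degree `e` vanishing on `Q`. -/
lemma exists_general_point [Infinite k] {d e : ℕ} {P Q : Finset (Fin (n + 1) → k)}
    (hP : P.card < (n + 1).multichoose d) (hQ : Q.card < (n + 1).multichoose e) :
    ∃ p : Fin (n + 1) → k, p 0 ≠ 0 ∧
      evalForm d p ∉ Submodule.span k (evalForm d '' (P : Set (Fin (n + 1) → k))) ∧
      evalForm e p ∉ Submodule.span k (evalForm e '' (Q : Set (Fin (n + 1) → k))) := by
  obtain ⟨f, -, hf, hfU⟩ := exists_form_of_lt_top (span_evalForm_lt_top hP)
  obtain ⟨g, -, hg, hgU⟩ := exists_form_of_lt_top (span_evalForm_lt_top hQ)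
  -- A single nonvanishing point of this product meets all three requirements; the factor `X 0`
  -- keeps it off the hyperplane.
  have h : X 0 * f * g ≠ 0 := mul_ne_zero (mul_ne_zero (X_ne_zero _) hf) hg
  obtain ⟨p, hp⟩ : ∃ p, eval p (X 0 * f * g) ≠ 0 := by
    by_contra! hc
    exact h (MvPolynomial.funext fun p => by rw [hc p, map_zero])
  rw [map_mul, map_mul, eval_X] at hp
  exact ⟨p, left_ne_zero_of_mul (left_ne_zero_of_mul hp),
    mt (hfU p) (right_ne_zero_of_mul (left_ne_zero_of_mul hp)),
    mt (hgU p) (right_ne_zero_of_mul hp)⟩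

/-- Points are added one at a time to whichever of the two sets is not yet full in degree `d`, each
chosen independent of that set in degree `d` and of the whole union in degree `e`. -/
lemma exists_independent_points [Infinite k] (n d e s : ℕ) (hs : s ≤ (n + 1).multichoose e)
    (hs' : s ≤ 2 * (n + 1).multichoose d) :
    ∃ P Q : Finset (Fin (n + 1) → k), Disjoint P Q ∧ P.card + Q.card = s ∧
      P.card ≤ (n + 1).multichoose d ∧ Q.card ≤ (n + 1).multichoose d ∧
      (∀ p, p ∈ P ∨ p ∈ Q → p 0 ≠ 0) ∧
      LinearIndepOn k (evalForm d) (P : Set (Fin (n + 1) → k)) ∧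
      LinearIndepOn k (evalForm d) (Q : Set (Fin (n + 1) → k)) ∧
      LinearIndepOn k (evalForm e) (P ∪ Q : Set (Fin (n + 1) → k)) := by
  classical
  induction s with
  | zero => exact ⟨∅, ∅, by simp⟩
  | succ s ih =>
    obtain ⟨P, Q, hdisj, hcard, hPd, hQd, h0, hP, hQ, hPQ⟩ := ih (by omega) (by omega)
    -- The two sets cannot both be full, since together they have fewer than `2 * (n +
    -- 1).multichoose d` points.
    wlog hlt : P.card < (n + 1).multichoose d generalizing P Q
    · exact this Q P hdisj.symm (by omega) hQd hPd (fun p hp => h0 p hp.symm) hQ hP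
        (by rwa [Set.union_comm]) (by omega)
    obtain ⟨p, hp0, hpP, hpPQ⟩ := exists_general_point (k := k) (P := P) (Q := P ∪ Q) hlt
      (e := e) (by rw [Finset.card_union_of_disjoint hdisj]; omega)
    have hmem : p ∉ P ∪ Q := fun h =>
      hpPQ (Submodule.subset_span (Set.mem_image_of_mem _ h))
    rw [Finset.mem_union, not_or] at hmem
    refine ⟨insert p P, Q, ?_, ?_, ?_, hQd, ?_, ?_, hQ, ?_⟩
    · exact Finset.disjoint_insert_left.2 ⟨hmem.2, hdisj⟩
    · rw [Finset.card_insert_of_notMem hmem.1]; omega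
    · rw [Finset.card_insert_of_notMem hmem.1]; omega
    · intro q hq
      rw [Finset.mem_insert, or_assoc] at hq
      rcases hq with rfl | hq
      · exact hp0
      · exact h0 q hq
    · rw [Finset.coe_insert]
      exact hP.insert hpP
    · rw [Finset.coe_insert, Set.insert_union]
      rw [Finset.coe_union] at hpPQ
      exact hPQ.insert hpPQ

lemma exists_form_eval_eq {d : ℕ} {P : Set (Fin n → k)} (hP : LinearIndepOn k (evalForm d) P)
    (c : (Fin n → k) → k) :
    ∃ f : MvPolynomial (Fin n) k, f.IsHomogeneous d ∧ ∀ p ∈ P, eval p f = c p := by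
  obtain ⟨g, hg⟩ := LinearMap.exists_extend
    (Finsupp.linearCombination k (fun p : P => c p) ∘ₗ hP.linearIndependent.repr)
  set f := (Module.evalEquiv k (homogeneousSubmodule (Fin n) k d)).symm g with hf
  refine ⟨f, f.2, fun p hp => ?_⟩
  rw [← evalForm_apply, hf, Module.apply_evalEquiv_symm_apply]
  have hm : evalForm d p ∈ Submodule.span k (Set.range fun q : P => evalForm d q.1) :=
    Submodule.subset_span ⟨⟨p, hp⟩, rfl⟩
  have := LinearMap.congr_fun hg ⟨evalForm d p, hm⟩
  rw [LinearMap.comp_apply, Submodule.subtype_apply] at this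
  rw [this, LinearMap.comp_apply,
    hP.linearIndependent.repr_eq_single ⟨p, hp⟩ _ rfl]
  simp

/-- Points off the hyperplane `x₀ = 0` on which forms of degree `d` take arbitrary values have the
same property with respect to forms of any larger degree. -/
lemma exists_form_eval_eq_of_le {d e : ℕ} (hde : d ≤ e) {P : Set (Fin (n + 1) → k)}
    (hP : LinearIndepOn k (evalForm d) P) (h0 : ∀ p ∈ P, p 0 ≠ 0) (c : (Fin (n + 1) → k) → k) :
    ∃ f : MvPolynomial (Fin (n + 1)) k, f.IsHomogeneous e ∧ ∀ p ∈ P, eval p f = c p := by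
  obtain ⟨f, hf, hfc⟩ := exists_form_eval_eq hP fun p => c p / p 0 ^ (e - d)
  -- The prescribed values were divided by this power of `p 0` in advance.
  refine ⟨X 0 ^ (e - d) * f, ?_, fun p hp => ?_⟩
  · simpa [Nat.sub_add_cancel hde] using (isHomogeneous_X_pow (R := k) 0 (e - d)).mul hf
  · rw [map_mul, map_pow, eval_X, hfc p hp, mul_div_cancel₀ _ (pow_ne_zero _ (h0 p hp))]

lemma form_eq_zero_of_card_eq {d : ℕ} {P : Finset (Fin n → k)}
    (hP : LinearIndepOn k (evalForm d) (P : Set (Fin n → k))) (hcard : P.card = n.multichoose d)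
    {f : MvPolynomial (Fin n) k} (hf : f.IsHomogeneous d) (hfP : ∀ p ∈ P, eval p f = 0) :
    f = 0 := by
  have hspan := hP.linearIndependent.span_eq_top_of_card_eq_finrank' (by
    rw [Subspace.dual_finrank_eq, finrank_homogeneousSubmodule, ← hcard]
    simp)
  have h : ∀ φ : Module.Dual k (homogeneousSubmodule (Fin n) k d), φ ⟨f, hf⟩ = 0 := by
    intro φ
    have hφ : φ ∈ Submodule.span k
        (Set.range fun q : (P : Set (Fin n → k)) => evalForm d q.1) := hspan ▸ Submodule.mem_top
    induction hφ using Submodule.span_induction with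
    | mem x hx =>
      obtain ⟨q, rfl⟩ := hx
      rw [evalForm_apply]
      exact hfP q.1 q.2
    | zero => rfl
    | add x y _ _ hx hy => rw [LinearMap.add_apply, hx, hy, add_zero]
    | smul a x _ hx => rw [LinearMap.smul_apply, hx, smul_zero]
  exact congrArg Subtype.val ((Module.forall_dual_apply_eq_zero_iff k _).1 h)

/-- Two disjoint finite sets of points, each of which imposes independent conditions on forms of
degree at least `m`, such that the union imposes independent conditions on forms of degree at least
`m + 3` and lies on no hypersurface of degree at most `m + 3`. -/
structure IsGeneralPair (m : ℕ) (P Q : Finset (Fin (n + 1) → k)) : Prop where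
  disjoint : Disjoint P Q
  left_nonempty : P.Nonempty
  right_nonempty : Q.Nonempty
  left : ∀ d, m ≤ d → ∀ c : (Fin (n + 1) → k) → k,
    ∃ f : MvPolynomial (Fin (n + 1)) k, f.IsHomogeneous d ∧ ∀ p ∈ P, eval p f = c p
  right : ∀ d, m ≤ d → ∀ c : (Fin (n + 1) → k) → k,
    ∃ f : MvPolynomial (Fin (n + 1)) k, f.IsHomogeneous d ∧ ∀ p ∈ Q, eval p f = c p
  union : ∀ d, m + 3 ≤ d → ∀ c : (Fin (n + 1) → k) → k,
    ∃ f : MvPolynomial (Fin (n + 1)) k, f.IsHomogeneous d ∧ ∀ p, p ∈ P ∨ p ∈ Q → eval p f = c p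
  eq_zero : ∀ d ≤ m + 3, ∀ f : MvPolynomial (Fin (n + 1)) k, f.IsHomogeneous d →
    (∀ p ∈ P, eval p f = 0) → (∀ p ∈ Q, eval p f = 0) → f = 0

/-- With exactly N(m+3) points in the union, independence in degree m + 3 means that evaluations
there form a basis of the dual. -/
lemma exists_isGeneralPair [Infinite k] (hn : 1 ≤ n) {m : ℕ} (hm : 4 * (n + 1) ≤ m) :
    ∃ P Q : Finset (Fin (n + 1) → k), IsGeneralPair m P Q := by
  classical
  obtain ⟨P, Q, hdisj, hcard, hPd, hQd, h0, hP, hQ, hPQ⟩ :=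
    exists_independent_points (k := k) n m (m + 3) ((n + 1).multichoose (m + 3)) le_rfl
      (multichoose_add_three_le hm)
  have hlt : (n + 1).multichoose m < (n + 1).multichoose (m + 3) := ((multichoose_lt_succ (n := n + 1) (by omega) m).trans
    (multichoose_lt_succ (by omega) (m + 1))).trans (multichoose_lt_succ (by omega) (m + 2))
  refine ⟨P, Q, hdisj, Finset.card_pos.1 (by omega), Finset.card_pos.1 (by omega),
    fun d hd => exists_form_eval_eq_of_le hd hP fun p hp => h0 p (Or.inl hp),
    fun d hd => exists_form_eval_eq_of_le hd hQ fun p hp => h0 p (Or.inr hp),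
    fun d hd => exists_form_eval_eq_of_le hd hPQ h0, ?_⟩
  intro d hd f hf hfP hfQ
  -- Lower degrees reduce to m + 3 by multiplying with a power of `X 0`.
  have hX : (X 0 ^ (m + 3 - d) * f).IsHomogeneous (m + 3) := by
    simpa [Nat.sub_add_cancel hd] using (isHomogeneous_X_pow (R := k) 0 (m + 3 - d)).mul hf
  have := form_eq_zero_of_card_eq (P := P ∪ Q) (by rwa [Finset.coe_union])
    (by rw [Finset.card_union_of_disjoint hdisj, hcard]) hX (by
      intro p hp
      rw [map_mul]
      rcases Finset.mem_union.1 hp with hp | hp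
      · rw [hfP p hp, mul_zero]
      · rw [hfQ p hp, mul_zero])
  exact (mul_eq_zero.1 this).resolve_left (pow_ne_zero _ (X_ne_zero _))

/-- Dual form of `eq_zero`: no nonzero form of degree at most m + 3 vanishes on all the points, so
their evaluations span. -/
lemma IsGeneralPair.exists_eq_sum_evalForm {m d : ℕ} {P Q : Finset (Fin (n + 1) → k)}
    (h : IsGeneralPair m P Q) (hd : d ≤ m + 3)
    (ψ : Module.Dual k (homogeneousSubmodule (Fin (n + 1)) k d)) :
    ∃ c : (Fin (n + 1) → k) → k,
      ∑ p ∈ P, c p • evalForm d p + ∑ p ∈ Q, c p • evalForm d p = ψ := by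
  classical
  have htop : Submodule.span k
      (evalForm d '' ((P ∪ Q : Finset _) : Set (Fin (n + 1) → k))) = ⊤ := by
    by_contra hne
    obtain ⟨f, hfd, hf, hfU⟩ := exists_form_of_lt_top (lt_top_iff_ne_top.2 hne)
    have hz : ∀ p ∈ P ∪ Q, eval p f = 0 := fun p hp =>
      hfU p (Submodule.subset_span (Set.mem_image_of_mem _ hp))
    exact hf (h.eq_zero d hd f hfd (fun p hp => hz p (Finset.mem_union_left _ hp))
      fun p hp => hz p (Finset.mem_union_right _ hp))
  have hψ : ψ ∈ Submodule.span k
      (evalForm d '' ((P ∪ Q : Finset _) : Set (Fin (n + 1) → k))) := htop ▸ Submodule.mem_top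
  rw [Submodule.mem_span_image_finset_iff_exists_fun'] at hψ
  obtain ⟨c, hc⟩ := hψ
  exact ⟨c, by rw [← hc, Finset.sum_union h.disjoint]⟩

end Points

/-! ### Restriction, normal derivatives and side points -/

section Construction

variable {k : Type*} [Field k] {n : ℕ}

/-- Setting the first two variables to zero. -/
noncomputable def restrictBase :
    MvPolynomial (Fin (n + 3)) k →ₐ[k] MvPolynomial (Fin (n + 1)) k :=
  aeval (Matrix.vecCons 0 (Matrix.vecCons 0 X))

/-- The inclusion of the polynomial ring in all variables but the first two. -/
noncomputable def inclBase :
    MvPolynomial (Fin (n + 1)) k →ₐ[k] MvPolynomial (Fin (n + 3)) k :=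
  rename fun i => i.succ.succ

@[simp] lemma restrictBase_X_zero :
    restrictBase (X 0 : MvPolynomial (Fin (n + 3)) k) = 0 := by
  simp [restrictBase]

@[simp] lemma restrictBase_X_one :
    restrictBase (X 1 : MvPolynomial (Fin (n + 3)) k) = 0 := by
  simp [restrictBase]

@[simp] lemma restrictBase_X_succ_succ (i : Fin (n + 1)) :
    restrictBase (X i.succ.succ : MvPolynomial (Fin (n + 3)) k) = X i := by
  simp [restrictBase]

@[simp] lemma restrictBase_inclBase (f : MvPolynomial (Fin (n + 1)) k) :
    restrictBase (inclBase f) = f := by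
  rw [restrictBase, inclBase, aeval_rename]
  exact aeval_X_left_apply f

lemma isHomogeneous_restrictBase {f : MvPolynomial (Fin (n + 3)) k} {d : ℕ}
    (hf : f.IsHomogeneous d) : (restrictBase f).IsHomogeneous d := by
  rw [restrictBase, ← one_mul d]
  refine hf.aeval _ fun i => ?_
  refine Fin.cases ?_ (fun i => Fin.cases ?_ (fun i => ?_) i) i
  · exact isHomogeneous_zero _ _ _
  · exact isHomogeneous_zero _ _ _
  · exact isHomogeneous_X _ _

lemma isHomogeneous_inclBase {f : MvPolynomial (Fin (n + 1)) k} {d : ℕ}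
    (hf : f.IsHomogeneous d) : (inclBase f).IsHomogeneous d :=
  hf.rename_isHomogeneous

/-- The partial derivative in the direction of the `i`-th variable at the point `(0, 0, p)`. -/
noncomputable def normalDeriv (i : Fin (n + 3)) (p : Fin (n + 1) → k) :
    MvPolynomial (Fin (n + 3)) k →ₗ[k] k :=
  (aeval p).toLinearMap ∘ₗ restrictBase.toLinearMap ∘ₗ (pderiv i).toLinearMap

lemma normalDeriv_apply (i : Fin (n + 3)) (p : Fin (n + 1) → k)
    (f : MvPolynomial (Fin (n + 3)) k) :
    normalDeriv i p f = eval p (restrictBase (pderiv i f)) := by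
  rw [← aeval_eq_eval]
  rfl

lemma normalDeriv_mul (i : Fin (n + 3)) (p : Fin (n + 1) → k)
    (f g : MvPolynomial (Fin (n + 3)) k) :
    normalDeriv i p (f * g) = eval p (restrictBase f) * normalDeriv i p g +
      normalDeriv i p f * eval p (restrictBase g) := by
  simp only [normalDeriv_apply, Derivation.leibniz, smul_eq_mul, map_add, map_mul]
  ring

@[simp] lemma normalDeriv_X (i l : Fin (n + 3)) (p : Fin (n + 1) → k) :
    normalDeriv i p (X l) = if l = i then 1 else 0 := by
  rw [normalDeriv_apply, pderiv_X, Pi.single_apply, eq_comm]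
  split_ifs <;> simp

lemma pderiv_inclBase {i : Fin (n + 3)} (hi : ∀ l : Fin (n + 1), l.succ.succ ≠ i)
    (f : MvPolynomial (Fin (n + 1)) k) : pderiv i (inclBase f) = 0 := by
  classical
  refine pderiv_eq_zero_of_notMem_vars fun h => ?_
  obtain ⟨l, -, hl⟩ := Finset.mem_image.1 (vars_rename _ f h)
  exact hi l hl

@[simp] lemma normalDeriv_zero_inclBase (p : Fin (n + 1) → k) (f : MvPolynomial (Fin (n + 1)) k) :
    normalDeriv 0 p (inclBase f) = 0 := by
  rw [normalDeriv_apply, pderiv_inclBase fun l => Fin.succ_ne_zero _, map_zero, map_zero]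

@[simp] lemma normalDeriv_one_inclBase (p : Fin (n + 1) → k) (f : MvPolynomial (Fin (n + 1)) k) :
    normalDeriv 1 p (inclBase f) = 0 := by
  rw [normalDeriv_apply, pderiv_inclBase, map_zero, map_zero]
  intro l h
  exact Fin.succ_ne_zero l (Fin.succ_injective _ h)

/-- The point `(1, 0, a, …, a)`. -/
def sidePoint (n : ℕ) (a : k) : Fin (n + 3) → k := Matrix.vecCons 1 (Matrix.vecCons 0 fun _ => a)

@[simp] lemma sidePoint_zero (a : k) : sidePoint n a 0 = 1 := rfl

@[simp] lemma sidePoint_two (a : k) : sidePoint n a 2 = a := rfl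

/-- Forms which are singular along `x₀ = x₁ = 0` take arbitrary values at finitely many side
points. -/
lemma exists_form_eval_sidePoint [CharZero k] {s d : ℕ} (hd : s + 1 ≤ d) (c : Fin s → k) :
    ∃ w : MvPolynomial (Fin (n + 3)) k, w.IsHomogeneous d ∧ restrictBase w = 0 ∧
      (∀ i p, normalDeriv i p w = 0) ∧ ∀ i : Fin s, eval (sidePoint n (i : k)) w = c i := by
  set v : Fin s → k := fun i => ((i : ℕ) : k) with hv
  have hinj : Set.InjOn v (Finset.univ : Finset (Fin s)) := fun a _ b _ h =>
    Fin.ext (Nat.cast_injective (R := k) h)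
  set q := Lagrange.interpolate Finset.univ v c with hq
  have hdeg : q.degree < s := by
    simpa only [Finset.card_univ, Fintype.card_fin] using Lagrange.degree_interpolate_lt c hinj
  -- The terms of the Lagrange interpolant, homogenised by `X 0`, which is 1 at side points. The
  -- factor `X 0` squared forces singularity along x₀ = x₁ = 0 and needs l + 2 ≤ d, whence the bound
  -- s + 1 ≤ d.
  set a : ℕ → MvPolynomial (Fin (n + 3)) k := fun l =>
    X 0 * (X 0 * (C (q.coeff l) * X 2 ^ l * X 0 ^ (d - l - 2))) with ha
  refine ⟨∑ l ∈ Finset.range s, a l, ?_, ?_, ?_, ?_⟩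
  · refine IsHomogeneous.sum _ _ _ fun l hl => ?_
    rw [Finset.mem_range] at hl
    have := (isHomogeneous_X k (0 : Fin (n + 3))).mul ((isHomogeneous_X k (0 : Fin (n + 3))).mul
      ((((isHomogeneous_X_pow (R := k) (2 : Fin (n + 3)) l).C_mul
        (q.coeff l))).mul (isHomogeneous_X_pow (R := k) (0 : Fin (n + 3)) (d - l - 2))))
    rwa [show 1 + (1 + (l + (d - l - 2))) = d by omega] at this
  · simp [ha]
  · intro i p
    rw [map_sum]
    refine Finset.sum_eq_zero fun l _ => ?_
    rw [ha]
    simp [normalDeriv_mul i p (X 0)]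
  · intro i
    have hqi : q.eval (i : k) = c i := Lagrange.eval_interpolate_at_node c hinj (Finset.mem_univ i)
    have hnat : q.natDegree < s := by
      rcases eq_or_ne q 0 with h0 | h0
      · rw [h0, Polynomial.natDegree_zero]
        exact i.pos
      · exact (Polynomial.natDegree_lt_iff_degree_lt h0).2 hdeg
    rw [← hqi, Polynomial.eval_eq_sum_range' hnat, map_sum]
    simp [ha]

end Construction

/-! ### The inverse system and its Hilbert function -/

section Construction

variable {k : Type*} [Field k] {n : ℕ} (P Q : Finset (Fin (n + 1) → k))

/-- The functional `f ↦ ∑_{p ∈ P} ∂₀f(0, 0, p) + ∑_{p ∈ Q} ∂₁f(0, 0, p)`. -/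
noncomputable def derivSum : MvPolynomial (Fin (n + 3)) k →ₗ[k] k :=
  ∑ p ∈ P, normalDeriv 0 p + ∑ p ∈ Q, normalDeriv 1 p

lemma derivSum_apply (f : MvPolynomial (Fin (n + 3)) k) :
    derivSum P Q f = ∑ p ∈ P, normalDeriv 0 p f + ∑ p ∈ Q, normalDeriv 1 p f := by
  simp [derivSum, LinearMap.sum_apply]

/-- The pairing of `f` with the forms of degree `e` in all variables but the first two. -/
noncomputable def derivPairing (e : ℕ) : MvPolynomial (Fin (n + 3)) k →ₗ[k]
    Module.Dual k (homogeneousSubmodule (Fin (n + 1)) k e) :=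
  ∑ p ∈ P, (normalDeriv 0 p).smulRight (evalForm e p) +
    ∑ p ∈ Q, (normalDeriv 1 p).smulRight (evalForm e p)

lemma derivPairing_eq (e : ℕ) (f : MvPolynomial (Fin (n + 3)) k) :
    derivPairing P Q e f = ∑ p ∈ P, normalDeriv 0 p f • evalForm e p +
      ∑ p ∈ Q, normalDeriv 1 p f • evalForm e p := by
  simp [derivPairing, LinearMap.sum_apply]

lemma derivPairing_apply (e : ℕ) (f : MvPolynomial (Fin (n + 3)) k)
    (a : homogeneousSubmodule (Fin (n + 1)) k e) :
    derivPairing P Q e f a = ∑ p ∈ P, normalDeriv 0 p f * eval p (a : MvPolynomial _ k) +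
      ∑ p ∈ Q, normalDeriv 1 p f * eval p (a : MvPolynomial _ k) := by
  simp [derivPairing_eq, LinearMap.sum_apply, evalForm_apply]

/-- Evaluation at the side points with last coordinates `0, 1, …, s - 1`. -/
noncomputable def evalSide (n s : ℕ) : MvPolynomial (Fin (n + 3)) k →ₗ[k] (Fin s → k) :=
  LinearMap.pi fun i => (aeval (sidePoint n (i : k))).toLinearMap

lemma evalSide_apply (s : ℕ) (f : MvPolynomial (Fin (n + 3)) k) (i : Fin s) :
    evalSide n s f i = eval (sidePoint n (i : k)) f := by
  rw [← aeval_eq_eval]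
  rfl

/-- The inverse system: `derivSum` together with the evaluations at `s` side points. -/
noncomputable def pairFunctional (s : ℕ) : MvPolynomial (Fin (n + 3)) k →ₗ[k] k × (Fin s → k) :=
  (derivSum P Q).prod (evalSide n s)

variable {P Q} {m s d : ℕ} {f : MvPolynomial (Fin (n + 3)) k}

lemma pairFunctional_eq_zero_iff :
    pairFunctional P Q s f = 0 ↔ derivSum P Q f = 0 ∧ evalSide n s f = 0 := by
  rw [pairFunctional, LinearMap.prod_apply]
  exact Prod.mk_eq_zero

lemma derivSum_mul (f g : MvPolynomial (Fin (n + 3)) k) :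
    derivSum P Q (f * g) =
      (∑ p ∈ P, eval p (restrictBase f) * normalDeriv 0 p g +
        ∑ p ∈ Q, eval p (restrictBase f) * normalDeriv 1 p g) +
      (∑ p ∈ P, normalDeriv 0 p f * eval p (restrictBase g) +
        ∑ p ∈ Q, normalDeriv 1 p f * eval p (restrictBase g)) := by
  simp only [derivSum_apply, normalDeriv_mul, Finset.sum_add_distrib]
  ring

lemma derivPairing_eq_zero_of_mem {j : ℕ} (hf : f.IsHomogeneous d) (hd : d ≤ j)
    (hI : f ∈ apolarIdeal j (pairFunctional P Q s)) : derivPairing P Q (j - d) f = 0 := by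
  ext a
  rw [mem_apolarIdeal_iff_of_isHomogeneous hf hd] at hI
  have := (pairFunctional_eq_zero_iff.1 (hI _ (isHomogeneous_inclBase a.2))).1
  rw [derivSum_mul] at this
  rw [derivPairing_apply]
  simpa using this

lemma evalSide_eq_zero_of_mem {j : ℕ} (hf : f.IsHomogeneous d) (hd : d ≤ j)
    (hI : f ∈ apolarIdeal j (pairFunctional P Q s)) : evalSide n s f = 0 := by
  ext i
  rw [mem_apolarIdeal_iff_of_isHomogeneous hf hd] at hI
  have := congrFun (pairFunctional_eq_zero_iff.1 (hI _ (isHomogeneous_X_pow 0 (j - d)))).2 i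
  rw [evalSide_apply] at this ⊢
  simpa using this

/-- Testing against `X 0 * inclBase b` and `X 1 * inclBase b` isolates the values of the restriction
on `P` and on `Q`. The cofactor `b` has degree 2m + 3 - d ≥ m, so it can be chosen to pick out one
point; then `eq_zero` applies. -/
lemma IsGeneralPair.restrictBase_eq_zero_of_mem (h : IsGeneralPair m P Q)
    (hf : f.IsHomogeneous d) (hd : d ≤ m + 3)
    (hI : f ∈ apolarIdeal (2 * m + 4) (pairFunctional P Q s)) : restrictBase f = 0 := by
  classical
  rw [mem_apolarIdeal_iff_of_isHomogeneous hf (by omega)] at hI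
  have hX : ∀ i (b : MvPolynomial (Fin (n + 1)) k), b.IsHomogeneous (2 * m + 4 - d - 1) →
      (X i * inclBase b : MvPolynomial (Fin (n + 3)) k).IsHomogeneous (2 * m + 4 - d) := by
    intro i b hb
    have := (isHomogeneous_X k i).mul (isHomogeneous_inclBase hb)
    rwa [show 1 + (2 * m + 4 - d - 1) = 2 * m + 4 - d by omega] at this
  refine h.eq_zero d hd _ (isHomogeneous_restrictBase hf) ?_ ?_
  · intro p hp
    obtain ⟨b, hb, hbp⟩ := h.left (2 * m + 4 - d - 1) (by omega) (Pi.single p 1)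
    have := (pairFunctional_eq_zero_iff.1 (hI _ (hX 0 b hb))).1
    rw [derivSum_mul] at this
    simp [normalDeriv_mul] at this
    rw [Finset.sum_congr rfl fun q hq => congrArg (_ * ·) (hbp q hq)] at this
    simpa [Pi.single_apply, hp] using this
  · intro p hp
    obtain ⟨b, hb, hbp⟩ := h.right (2 * m + 4 - d - 1) (by omega) (Pi.single p 1)
    have := (pairFunctional_eq_zero_iff.1 (hI _ (hX 1 b hb))).1
    rw [derivSum_mul] at this
    simp [normalDeriv_mul] at this
    rw [Finset.sum_congr rfl fun q hq => congrArg (_ * ·) (hbp q hq)] at this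
    simpa [Pi.single_apply, hp] using this

lemma mem_apolarIdeal_pairFunctional {j : ℕ} (hf : f.IsHomogeneous d) (hd : d ≤ j)
    (h₀ : restrictBase f = 0) (h₁ : derivPairing P Q (j - d) f = 0) (h₂ : evalSide n s f = 0) :
    f ∈ apolarIdeal j (pairFunctional P Q s) := by
  rw [mem_apolarIdeal_iff_of_isHomogeneous hf hd]
  intro g hg
  rw [pairFunctional_eq_zero_iff]
  constructor
  · have := LinearMap.congr_fun h₁ ⟨restrictBase g, isHomogeneous_restrictBase hg⟩
    rw [derivPairing_apply] at this
    rw [derivSum_mul]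
    simpa [h₀] using this
  · ext i
    have := congrFun h₂ i
    rw [evalSide_apply] at this ⊢
    rw [map_mul, this, Pi.zero_apply, zero_mul]

/-- Normal derivatives of a linear form are its first two coefficients, the same at every point. A
form of degree 2m + 3 that is 1 at one point of the union and 0 at the others detects each of them;
the restriction detects the remaining coefficients. -/
lemma IsGeneralPair.eq_zero_of_mem (h : IsGeneralPair m P Q) (hf : f.IsHomogeneous 1)
    (hI : f ∈ apolarIdeal (2 * m + 4) (pairFunctional P Q s)) : f = 0 := by
  classical
  have h₀ := h.restrictBase_eq_zero_of_mem hf (by omega) hI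
  have h₁ := derivPairing_eq_zero_of_mem hf (by omega) hI
  have key : ∀ p, p ∈ P ∨ p ∈ Q → ∑ q ∈ P, normalDeriv 0 q f * (if q = p then 1 else 0) +
      ∑ q ∈ Q, normalDeriv 1 q f * (if q = p then 1 else 0) = 0 := by
    intro p hp
    obtain ⟨a, ha, hap⟩ := h.union (2 * m + 4 - 1) (by omega)
      fun q => if q = p then 1 else 0
    have := LinearMap.congr_fun h₁ ⟨a, ha⟩
    rw [derivPairing_apply, LinearMap.zero_apply] at this
    refine Eq.trans ?_ this
    exact congrArg₂ _ (Finset.sum_congr rfl fun q hq =>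
      congrArg (_ * ·) (hap q (Or.inl hq)).symm)
      (Finset.sum_congr rfl fun q hq =>
        congrArg (_ * ·) (hap q (Or.inr hq)).symm)
  have hspan : f ∈ Submodule.span k (Set.range (X : Fin (n + 3) → MvPolynomial (Fin (n + 3)) k)) :=
    homogeneousSubmodule_one_eq_span_X (σ := Fin (n + 3)) (R := k) ▸ hf
  obtain ⟨c, rfl⟩ := (Submodule.mem_span_range_iff_exists_fun k).1 hspan
  have hc : ∀ i p, normalDeriv i p (∑ l, c l • X l) = c i := by
    intro i p
    simp
  simp only [hc] at key
  obtain ⟨p, hp⟩ := h.left_nonempty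
  obtain ⟨q, hq⟩ := h.right_nonempty
  have hc₀ : c 0 = 0 := by
    have hpQ : p ∉ Q := Finset.disjoint_left.1 h.disjoint hp
    simpa [hp, hpQ] using key p (Or.inl hp)
  have hc₁ : c 1 = 0 := by
    have hqP : q ∉ P := Finset.disjoint_right.1 h.disjoint hq
    simpa [hq, hqP] using key q (Or.inr hq)
  have hc₂ : ∀ i : Fin (n + 1), c i.succ.succ = 0 := by
    intro i
    have := congrArg (eval (Pi.single i 1)) h₀
    rw [Fin.sum_univ_succ, Fin.sum_univ_succ] at this
    simpa [smul_eval, Pi.single_apply] using this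
  refine Finset.sum_eq_zero fun i _ => ?_
  rw [show c i = 0 from Fin.cases hc₀ (fun i => Fin.cases hc₁ hc₂ i) i, zero_smul]

variable [CharZero k]

lemma IsGeneralPair.hilbertFunction_top (h : IsGeneralPair m P Q) (hs : s ≤ m) :
    hilbertFunction (apolarIdeal (2 * m + 4) (pairFunctional P Q s)) (2 * m + 4) = s + 1 := by
  classical
  rw [hilbertFunction_eq_finrank
    (pairFunctional P Q s ∘ₗ (homogeneousSubmodule (Fin (n + 3)) k (2 * m + 4)).subtype)]
  · simp [add_comm]
  · rintro ⟨x, y⟩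
    obtain ⟨p, hp⟩ := h.left_nonempty
    obtain ⟨b, hb, hbp⟩ := h.left (2 * m + 3) (by omega) (Pi.single p x)
    set g : MvPolynomial (Fin (n + 3)) k := X 0 * inclBase b with hg
    -- The correction `w` repairs the side values of `g` without changing its normal derivatives.
    obtain ⟨w, hw, hw₀, hw₁, hw₂⟩ := exists_form_eval_sidePoint (n := n) (d := 2 * m + 4)
      (by omega) (y - evalSide n s g)
    have hgh : g.IsHomogeneous (2 * m + 4) := by
      have := (isHomogeneous_X k 0).mul (isHomogeneous_inclBase hb)
      rwa [show 1 + (2 * m + 3) = 2 * m + 4 by omega] at this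
    refine ⟨⟨g + w, hgh.add hw⟩, Prod.ext ?_ ?_⟩
    · change derivSum P Q (g + w) = x
      simp only [derivSum_apply, map_add, hw₁, hg, normalDeriv_mul]
      simp [Finset.sum_congr rfl hbp, Pi.single_apply, hp]
    · change evalSide n s (g + w) = y
      ext i
      rw [map_add, Pi.add_apply, evalSide_apply s w, hw₂]
      simp
  · rintro ⟨f, hf⟩
    rw [mem_apolarIdeal_iff_of_isHomogeneous hf le_rfl, Nat.sub_self]
    constructor
    · intro h0 g hg
      rw [totalDegree_eq_zero_iff_eq_C.1 ((totalDegree_zero_iff_isHomogeneous _).2 hg), mul_comm,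
        C_mul', map_smul]
      exact (congrArg _ h0).trans (smul_zero _)
    · intro h0
      simpa using h0 1 (isHomogeneous_one _ _)

/-- The degree-`d` piece is identified with forms of degree `d` on the base, plus the dual of forms
of degree `e`, plus `Fin s → k`. The range is forced: d, e ≤ m + 3 is needed for `eq_zero` and for
evaluations to span, and d - 1 ≥ m to prescribe normal derivatives on `P` and `Q` separately. -/
lemma IsGeneralPair.hilbertFunction_middle (h : IsGeneralPair m P Q) (hs : s ≤ m) {e : ℕ}
    (hd : m + 1 ≤ d) (he : m + 1 ≤ e) (hde : d + e = 2 * m + 4) :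
    hilbertFunction (apolarIdeal (2 * m + 4) (pairFunctional P Q s)) d =
      (n + 1).multichoose d + ((n + 1).multichoose e + s) := by
  classical
  obtain rfl : e = 2 * m + 4 - d := by omega
  rw [hilbertFunction_eq_finrank
    ((restrictBase.toLinearMap.restrict fun f hf => isHomogeneous_restrictBase hf :
        homogeneousSubmodule (Fin (n + 3)) k d →ₗ[k] homogeneousSubmodule (Fin (n + 1)) k d).prod
      (((derivPairing P Q (2 * m + 4 - d)).prod (evalSide n s)) ∘ₗ
        (homogeneousSubmodule (Fin (n + 3)) k d).subtype))]
  · simp [finrank_homogeneousSubmodule, Subspace.dual_finrank_eq]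
  · rintro ⟨⟨a, ha⟩, ψ, y⟩
    obtain ⟨c, hc⟩ := h.exists_eq_sum_evalForm (d := 2 * m + 4 - d) (by omega) ψ
    obtain ⟨b₀, hb₀, hbc₀⟩ := h.left (d - 1) (by omega) c
    obtain ⟨b₁, hb₁, hbc₁⟩ := h.right (d - 1) (by omega) c
    set g : MvPolynomial (Fin (n + 3)) k :=
      inclBase a + (X 0 * inclBase b₀ + X 1 * inclBase b₁) with hg
    obtain ⟨w, hw, hw₀, hw₁, hw₂⟩ := exists_form_eval_sidePoint (n := n) (d := d)
      (by omega) (y - evalSide n s g)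
    have hgh : g.IsHomogeneous d := by
      have h₀ := (isHomogeneous_X k (0 : Fin (n + 3))).mul (isHomogeneous_inclBase hb₀)
      have h₁ := (isHomogeneous_X k (1 : Fin (n + 3))).mul (isHomogeneous_inclBase hb₁)
      rw [show 1 + (d - 1) = d by omega] at h₀ h₁
      exact (isHomogeneous_inclBase ha).add (h₀.add h₁)
    refine ⟨⟨g + w, hgh.add hw⟩, Prod.ext (Subtype.ext ?_) (Prod.ext ?_ ?_)⟩
    · change restrictBase (g + w) = a
      simp [hg, hw₀]
    · change derivPairing P Q _ (g + w) = ψ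
      have e₀ : ∀ p ∈ P, normalDeriv 0 p (g + w) = c p := fun p hp => by
        simp [hg, hw₁, normalDeriv_mul, hbc₀ p hp]
      have e₁ : ∀ p ∈ Q, normalDeriv 1 p (g + w) = c p := fun p hp => by
        simp [hg, hw₁, normalDeriv_mul, hbc₁ p hp]
      rw [← hc, derivPairing_eq]
      exact congrArg₂ _ (Finset.sum_congr rfl fun p hp => by rw [e₀ p hp])
        (Finset.sum_congr rfl fun p hp => by rw [e₁ p hp])
    · change evalSide n s (g + w) = y
      ext i
      rw [map_add, Pi.add_apply, evalSide_apply s w, hw₂]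
      simp
  · rintro ⟨f, hf⟩
    constructor
    · intro h0
      exact mem_apolarIdeal_pairFunctional hf (by omega)
        (congrArg Subtype.val (congrArg Prod.fst h0)) (congrArg (fun z => z.2.1) h0)
        (congrArg (fun z => z.2.2) h0)
    · intro hI
      exact Prod.ext (Subtype.ext (h.restrictBase_eq_zero_of_mem hf (by omega) hI))
        (Prod.ext (derivPairing_eq_zero_of_mem hf (by omega) hI)
          (evalSide_eq_zero_of_mem hf (by omega) hI))

end Construction

end LevelAlgebra

theorem mainTheorem3 {k : Type*} [Field k] [IsAlgClosed k] [CharZero k]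
    (r t : ℕ) (hr : 5 ≤ r) (ht : 1 ≤ t) :
    ∃ (I : Ideal (MvPolynomial (Fin r) k)) (j : ℕ),
      LevelAlgebra.IsLevel I j t ∧
        ¬ LevelAlgebra.IsUnimodal (LevelAlgebra.hilbertFunction I) j := by
  obtain ⟨n, rfl⟩ : ∃ n, r = n + 3 := ⟨r - 3, by omega⟩
  obtain ⟨s, rfl⟩ : ∃ s, t = s + 1 := ⟨t - 1, by omega⟩
  -- The first summand makes room for the general points, the second gives s ≤ m for the side
  -- points.
  set m := 4 * (n + 1) + s with hm
  obtain ⟨P, Q, h⟩ := LevelAlgebra.exists_isGeneralPair (k := k) (n := n) (m := m)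
    (by omega) (by omega)
  refine ⟨LevelAlgebra.apolarIdeal (2 * m + 4) (LevelAlgebra.pairFunctional P Q s), 2 * m + 4,
    LevelAlgebra.isLevel_apolarIdeal (by omega) (by omega) (fun f hI hf => h.eq_zero_of_mem hf hI)
      (h.hilbertFunction_top (by omega)),
    LevelAlgebra.not_isUnimodal (m := m + 2) (by omega) (by omega) ?_ ?_⟩
  all_goals
    have hconv := LevelAlgebra.two_mul_multichoose_lt (n := n + 1) (m := m + 2) (by omega) (by omega)
    rw [show m + 2 + 1 = m + 3 from rfl, Nat.add_sub_cancel_right (m + 1) 1] at hconv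
    rw [h.hilbertFunction_middle (by omega) (d := m + 2) (e := m + 2) (by omega) (by omega)
      (by omega)]
  · rw [Nat.add_sub_cancel_right (m + 1) 1, h.hilbertFunction_middle (by omega) (d := m + 1)
      (e := m + 3) (by omega) (by omega) (by omega)]
    omega
  · rw [h.hilbertFunction_middle (by omega) (d := m + 3) (e := m + 1) (by omega) (by omega)
      (by omega)]
    omega
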